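/- Let $X$ be a complex Banach space, let $L(X)$ be the Banach algebra of bounded linear operators on $X$, and let $T\in L(X)$. An operator $U$ on a complex Banach space is called meromorphic if every nonzero point of its spectrum $\sigma(U)$ is a pole of its resolvent, that is, an isolated point of $\sigma(U)$ at which $z\mapsto (z-U)^{-1}$ has a pole. An element $a$ of a unital algebra is called Drazin invertible if there exist an element $b$ and $m\in\mathbb N$ with $a^mba=a^m$, $bab=b$ and $ab=ba$; the Drazin spectrum of $T$ is $\sigma_{\mathcal{DR}}(T)=\{\lambda\in\mathbb C : T-\lambda I \text{ is not Drazin invertible in } L(X)\}$. Let $L_T,R_T\in L(L(X))$ be given by $L_T(U)=TU$ and $R_T(U)=UT$. (a) The following statements are equivalent: (i) $T$ is meromorphic; (ii) $\sigma_{\mathcal{DR}}(T)\subseteq\{0\}$; (iii) $L_T\in L(L(X))$ is meromorphic; (iv) $R_T\in L(L(X))$ is meromorphic. (b) For every $S\in L(X)$, $ST$ is meromorphic if and only if $TS$ is meromorphic. (c) Let $F\in L(X)$ commute with $T$, and suppose that $F^n$ has finite-dimensional range for some positive integer $n$. If $T$ is meromorphic, then $T+F$ is meromorphic. -/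

import Mathlib

open Filter Topology

namespace DrazinSpectrum

/-- An element `a` is Drazin invertible if there are `b` and `m` with
`a ^ m * b * a = a ^ m`, `b * a * b = b` and `a * b = b * a`. -/
def IsDrazinInvertible {A : Type*} [Ring A] (a : A) : Prop :=
  ∃ (b : A) (m : ℕ), a ^ m * b * a = a ^ m ∧ b * a * b = b ∧ a * b = b * a

/-- The Drazin spectrum: all complex `μ` for which `a - μ` is not Drazin invertible. -/
def drazinSpectrum {A : Type*} [Ring A] [Algebra ℂ A] (a : A) : Set ℂ :=
  {μ : ℂ | ¬ IsDrazinInvertible (a - algebraMap ℂ A μ)}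

/-- The set of poles of the resolvent of `a`: isolated points `μ` of the spectrum at which
the resolvent function `z ↦ (z - a)⁻¹`, holomorphic on a punctured neighbourhood of `μ`, has a pole
(it is meromorphic at `μ`, of negative order). -/
def resolventPoles {A : Type*} [NormedRing A] [NormedAlgebra ℂ A] (a : A) : Set ℂ :=
  {μ : ℂ | μ ∈ spectrum ℂ a ∧ (∀ᶠ z in 𝓝[≠] μ, z ∉ spectrum ℂ a) ∧
    MeromorphicAt (fun z : ℂ => resolvent a z) μ ∧
    meromorphicOrderAt (fun z : ℂ => resolvent a z) μ < 0}

/-- A bounded operator is meromorphic if every nonzero point of its spectrum is a pole of its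
resolvent. -/
def IsMeromorphicOperator {X : Type*} [NormedAddCommGroup X] [NormedSpace ℂ X]
    (T : X →L[ℂ] X) : Prop :=
  spectrum ℂ T \ {0} ⊆ resolventPoles T

/-- The operator `L_T` of left multiplication by `T`, acting on the space of bounded operators. -/
noncomputable def leftMul {X : Type*} [NormedAddCommGroup X] [NormedSpace ℂ X]
    (T : X →L[ℂ] X) : (X →L[ℂ] X) →L[ℂ] (X →L[ℂ] X) :=
  ContinuousLinearMap.mul ℂ (X →L[ℂ] X) T

/-- The operator `R_T` of right multiplication by `T`, acting on the space of bounded operators. -/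
noncomputable def rightMul {X : Type*} [NormedAddCommGroup X] [NormedSpace ℂ X]
    (T : X →L[ℂ] X) : (X →L[ℂ] X) →L[ℂ] (X →L[ℂ] X) :=
  (ContinuousLinearMap.mul ℂ (X →L[ℂ] X)).flip T

theorem leftMul_apply {X : Type*} [NormedAddCommGroup X] [NormedSpace ℂ X]
    (T U : X →L[ℂ] X) : leftMul T U = T * U := rfl

theorem rightMul_apply {X : Type*} [NormedAddCommGroup X] [NormedSpace ℂ X]
    (T U : X →L[ℂ] X) : rightMul T U = U * T := rfl

end DrazinSpectrum

/-!
Everything is reduced to Drazin invertibility, used in the form of commuting strong `π`-regularity: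
`a ^ n = a ^ (n + 1) * x` for some `x` commuting with `a` (`isDrazinInvertible_of_pow_eq`). The
Drazin inverse lies in the double commutant of `a` (`IsDrazinInvertible.exists_doubleCommutant`).

The bridge to operator theory is that, for a point `μ` of the spectrum of `a`, the element `a - μ`
is Drazin invertible exactly when `μ` is a pole of the resolvent. At a pole, comparing Taylor
coefficients in `(z - a) * resolvent a z = 1` yields strong `π`-regularity
(`exists_pow_eq_of_analyticAt`). Conversely, the Drazin inverse provides a Laurent expansion of the
resolvent with finite principal part (`isUnit_sub_and_inverse_eq_laurent`). Hence an operator is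
meromorphic if and only if its Drazin spectrum is contained in `{0}`
(`isMeromorphicOperator_iff`), and the three assertions become algebraic.

* Left and right multiplication by `T` have the same Drazin spectrum as `T`: a Drazin inverse of
  the former commutes with every right multiplication, so it is itself a left multiplication.
* Products `S * T` and `T * S` have the same nonzero Drazin spectrum by Jacobson's lemma for
  `1 - a * b` and `1 - b * a` (`IsDrazinInvertible.one_sub_mul_swap`).
* An operator with a power of finite rank is algebraic, and algebraic elements are Drazin
  invertible. If `c` has Drazin inverse `b` and `F` commutes with `c` and has a power of finite
  rank, then `c + F` splits along the idempotent `c * b` into a product of commuting Drazin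
  invertible elements and an operator with a power of finite rank
  (`IsDrazinInvertible.add_of_finiteDimensional_range_pow`).
-/

namespace DrazinSpectrum

/-! ### Drazin invertible elements of rings -/

section Ring

variable {A : Type*} [Ring A] {a b p x y u : A}

/-- Drazin invertibility is strong `π`-regularity with commuting witness: the identity
`b * a * b = b` can be dropped. -/
theorem isDrazinInvertible_of_pow_eq (h : Commute a x) (n : ℕ) (hx : a ^ n = a ^ (n + 1) * x) :
    IsDrazinInvertible a := by
  have hk : ∀ k, a ^ n * (a * x) ^ k = a ^ n := by
    intro k
    induction k with
    | zero => simp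
    | succ k ih => rw [pow_succ', ← mul_assoc, ← mul_assoc, ← pow_succ, ← hx, ih]
  have hba : a ^ n * x ^ (n + 1) * a = a ^ n * x ^ n := by
    rw [mul_assoc, pow_succ', mul_assoc, ← (h.pow_right n).eq, ← mul_assoc x, ← h.eq,
      ← mul_assoc, ← pow_one (a * x), hk]
  refine ⟨a ^ n * x ^ (n + 1), n, ?_, ?_, ?_⟩
  · rw [mul_assoc, hba, ← h.mul_pow, hk]
  · rw [hba, ← mul_assoc, mul_assoc (a ^ n), (h.symm.pow_pow n n).eq, ← h.mul_pow, hk]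
  · rw [((Commute.refl a).pow_right n |>.mul_right (h.pow_right (n + 1))).eq]

/-- The Drazin inverse of `a` lies in the double commutant of `a`. -/
theorem IsDrazinInvertible.exists_doubleCommutant (h : IsDrazinInvertible a) :
    ∃ b : A, (∀ u, Commute a u → Commute b u) ∧ b * a * b = b ∧
      ∃ n, ∀ k, n ≤ k → a ^ (k + 1) * b = a ^ k := by
  obtain ⟨b, m, h1, h2, h3⟩ := h
  have hab : Commute a b := h3
  have hpow : ∀ k, m ≤ k → a ^ (k + 1) * b = a ^ k := by
    intro k hk
    obtain ⟨j, rfl⟩ := Nat.exists_eq_add_of_le' hk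
    rw [pow_succ, mul_assoc, h3, pow_add, mul_assoc, ← mul_assoc (a ^ m), h1]
  refine ⟨b, fun u hu => ?_, h2, m, hpow⟩
  have hp : IsIdempotentElem (a * b) := by
    rw [IsIdempotentElem, mul_assoc, ← mul_assoc b, h2]
  have hpn : (a * b) ^ (m + 1) = a * b := hp.pow_succ_eq m
  have hr : a ^ (m + 1) * (1 - a * b) = 0 := by
    rw [mul_sub, mul_one, ← mul_assoc, ← pow_succ, hpow _ (Nat.le_succ m), sub_self]
  have hl : (1 - a * b) * a ^ (m + 1) = 0 := by
    rw [← hr]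
    exact ((Commute.one_left _).sub_left
      ((Commute.refl a).mul_left hab.symm |>.pow_right (m + 1))).eq
  have hu' : a ^ (m + 1) * u = u * a ^ (m + 1) := (hu.pow_left (m + 1)).eq
  -- The off-diagonal corners of `u` with respect to the idempotent `a * b` vanish.
  have e1 : a * b * u = a * b * u * (a * b) := by
    have : a * b * u * (1 - a * b) = 0 := by
      have : a * b * u = b ^ (m + 1) * u * a ^ (m + 1) := by
        rw [mul_assoc _ u, ← hu', ← mul_assoc, (hab.symm.pow_pow _ _).eq, ← hab.mul_pow, hpn]
      rw [this, mul_assoc, hr, mul_zero]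
    rwa [mul_sub, mul_one, sub_eq_zero] at this
  have e2 : u * (a * b) = a * b * u * (a * b) := by
    have : (1 - a * b) * (u * (a * b)) = 0 := by
      have : u * (a * b) = a ^ (m + 1) * (u * b ^ (m + 1)) := by
        rw [← mul_assoc (a ^ (m + 1)), hu', mul_assoc u (a ^ (m + 1)), ← hab.mul_pow, hpn]
      rw [this, ← mul_assoc, hl, zero_mul]
    rw [sub_mul, one_mul, sub_eq_zero] at this
    rw [this, mul_assoc (a * b)]
  have hpu : a * b * u = u * (a * b) := e1.trans e2.symm
  have hb : b = b * (a * b) := by rw [← mul_assoc, h2]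
  have hb' : b = a * b * b := by rw [h3, h2]
  calc b * u = b * (a * b * u) := by rw [← mul_assoc, ← hb]
    _ = b * (u * a) * b := by rw [hpu]; simp only [mul_assoc]
    _ = a * b * u * b := by rw [← hu.eq, h3]; simp only [mul_assoc]
    _ = u * b := by rw [hpu, mul_assoc, ← hb']

theorem isDrazinInvertible_of_isUnit (h : IsUnit a) : IsDrazinInvertible a := by
  obtain ⟨v, rfl⟩ := h
  exact ⟨↑v⁻¹, 0, by simp, by simp, by simp⟩

theorem IsDrazinInvertible.mul (ha : IsDrazinInvertible a) (hb : IsDrazinInvertible b)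
    (hab : Commute a b) : IsDrazinInvertible (a * b) := by
  obtain ⟨x, hx, -, n, hn⟩ := ha.exists_doubleCommutant
  obtain ⟨y, hy, -, m, hm⟩ := hb.exists_doubleCommutant
  have hxa := hx a rfl
  have hxb := hx b hab
  have hyb := hy b rfl
  have hya := hy a hab.symm
  have hxy := hx y hya.symm
  refine isDrazinInvertible_of_pow_eq (x := x * y)
    ((hxa.symm.mul_left hxb.symm).mul_right (hya.symm.mul_left hyb.symm)) (max n m) ?_
  rw [hab.mul_pow, hab.mul_pow, ← mul_assoc, mul_assoc (a ^ (max n m + 1)),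
    ← (hxb.pow_right _).eq, ← mul_assoc, hn _ (le_max_left _ _), mul_assoc,
    hm _ (le_max_right _ _)]

/-- Drazin invertibility can be checked on the two corners of a commuting idempotent. -/
theorem isDrazinInvertible_of_corners (hp : IsIdempotentElem p) (hap : Commute a p)
    (h1 : IsDrazinInvertible (a * p)) (h2 : IsDrazinInvertible (a * (1 - p))) :
    IsDrazinInvertible a := by
  obtain ⟨x, hx, -, n, hn⟩ := h1.exists_doubleCommutant
  obtain ⟨y, hy, -, m, hm⟩ := h2.exists_doubleCommutant
  have haq : Commute a (1 - p) := (Commute.one_right a).sub_right hap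
  have hxa := hx a ((Commute.refl a).mul_left hap.symm)
  have hya := hy a ((Commute.refl a).mul_left haq.symm)
  have e1 := hn (max n m + 1) ((le_max_left _ _).trans (Nat.le_succ _))
  have e2 := hm (max n m + 1) ((le_max_right _ _).trans (Nat.le_succ _))
  rw [hap.mul_pow, hap.mul_pow, hp.pow_succ_eq, hp.pow_succ_eq, mul_assoc] at e1
  rw [haq.mul_pow, haq.mul_pow, hp.one_sub.pow_succ_eq, hp.one_sub.pow_succ_eq, mul_assoc] at e2
  refine isDrazinInvertible_of_pow_eq (x := p * x + (1 - p) * y)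
    ((hap.mul_right hxa.symm).add_right (haq.mul_right hya.symm)) (max n m + 1) ?_
  rw [mul_add, e1, e2, ← mul_add, add_sub_cancel, mul_one]

/-- Jacobson's lemma for Drazin inverses. -/
theorem IsDrazinInvertible.one_sub_mul_swap (h : IsDrazinInvertible (1 - a * b)) :
    IsDrazinInvertible (1 - b * a) := by
  obtain ⟨x, hx, -, n, hn⟩ := h.exists_doubleCommutant
  have hn := hn n le_rfl
  have hxc : (1 - a * b) * x = x * (1 - a * b) := (hx _ rfl).eq.symm
  have hb : (1 - b * a) * b = b * (1 - a * b) := by noncomm_ring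
  have ha : a * (1 - b * a) = (1 - a * b) * a := by noncomm_ring
  have hbn : ∀ k, (1 - b * a) ^ k * b = b * (1 - a * b) ^ k := by
    intro k
    induction k with
    | zero => simp
    | succ k ih => rw [pow_succ, mul_assoc, hb, ← mul_assoc, ih, mul_assoc, ← pow_succ]
  -- With `β = 1 - b * a` and `α = 1 - a * b`, the choice of witness gives
  -- `1 - β * (1 + b * x * a) = b * (1 - α * x) * a`, which `β ^ n` annihilates.
  refine isDrazinInvertible_of_pow_eq (x := 1 + b * x * a) ?_ n ?_
  · refine (Commute.one_right _).add_right ?_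
    rw [Commute, SemiconjBy, mul_assoc (b * x), ha, ← mul_assoc, ← mul_assoc, hb,
      mul_assoc b, hxc]
    simp only [mul_assoc]
  · have key : (1 - b * a) ^ (n + 1) * (1 + b * x * a) - (1 - b * a) ^ n
        = (1 - b * a) ^ n * b * ((1 - a * b) * x - 1) * a := by
      have : (1 - b * a) * (b * x * a) = b * ((1 - a * b) * x) * a := by
        rw [← mul_assoc, ← mul_assoc, hb]; simp only [mul_assoc]
      rw [pow_succ, mul_assoc, mul_add, this]
      noncomm_ring
    have hz : (1 - b * a) ^ n * b * ((1 - a * b) * x - 1) = 0 := by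
      rw [hbn, mul_assoc, mul_sub, ← mul_assoc, ← pow_succ, hn, mul_one, sub_self, mul_zero]
    rw [hz, zero_mul, sub_eq_zero] at key
    exact key.symm

end Ring

/-! ### Drazin invertible elements of complex algebras -/

section Algebra

variable {A : Type*} [Ring A] [Algebra ℂ A] {a b : A}

theorem isDrazinInvertible_smul_iff {r : ℂ} (hr : r ≠ 0) :
    IsDrazinInvertible (r • a) ↔ IsDrazinInvertible a := by
  have aux : ∀ (s : ℂ) (_ : s ≠ 0) (c : A), IsDrazinInvertible c →
      IsDrazinInvertible (s • c) := by
    intro s hs c hc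
    rw [Algebra.smul_def]
    exact (isDrazinInvertible_of_isUnit ((IsUnit.mk0 s hs).map (algebraMap ℂ A))).mul hc
      (Algebra.commutes s c)
  refine ⟨fun h => ?_, aux r hr a⟩
  simpa [smul_smul, hr] using aux r⁻¹ (inv_ne_zero hr) _ h

theorem IsDrazinInvertible.mul_sub_algebraMap_swap {μ : ℂ} (hμ : μ ≠ 0)
    (h : IsDrazinInvertible (a * b - algebraMap ℂ A μ)) :
    IsDrazinInvertible (b * a - algebraMap ℂ A μ) := by
  have e1 : a * b - algebraMap ℂ A μ = (-μ) • (1 - (μ⁻¹ • a) * b) := by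
    rw [smul_sub, smul_mul_assoc, smul_smul, neg_mul, mul_inv_cancel₀ hμ,
      Algebra.algebraMap_eq_smul_one]
    module
  have e2 : b * a - algebraMap ℂ A μ = (-μ) • (1 - b * (μ⁻¹ • a)) := by
    rw [smul_sub, mul_smul_comm, smul_smul, neg_mul, mul_inv_cancel₀ hμ,
      Algebra.algebraMap_eq_smul_one]
    module
  rw [e1, isDrazinInvertible_smul_iff (neg_ne_zero.2 hμ)] at h
  rw [e2, isDrazinInvertible_smul_iff (neg_ne_zero.2 hμ)]
  exact h.one_sub_mul_swap

theorem isDrazinInvertible_of_isAlgebraic (h : IsAlgebraic ℂ a) : IsDrazinInvertible a := by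
  obtain ⟨q, hq0, hq⟩ := h
  obtain ⟨r, hr, hnd⟩ := q.exists_eq_pow_rootMultiplicity_mul_and_not_dvd hq0 0
  set k := q.rootMultiplicity 0
  have hr0 : r.coeff 0 ≠ 0 := by
    simpa [Polynomial.X_dvd_iff] using hnd
  -- Write `r = X * s + r₀` with `r₀ ≠ 0`; then `a ^ k * r(a) = 0` is solved for `a ^ k`.
  have hs : Polynomial.aeval a r = a * Polynomial.aeval a r.divX + algebraMap ℂ A (r.coeff 0) := by
    conv_lhs => rw [← r.X_mul_divX_add]
    simp only [map_add, map_mul, Polynomial.aeval_X, Polynomial.aeval_C]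
  rw [hr] at hq
  simp only [map_zero, sub_zero, map_mul, map_pow, Polynomial.aeval_X, hs] at hq
  have hc : Commute a (Polynomial.aeval a r.divX) := by
    simpa using (Commute.all (Polynomial.X) r.divX).map (Polynomial.aeval a)
  refine isDrazinInvertible_of_pow_eq (x := -(r.coeff 0)⁻¹ • Polynomial.aeval a r.divX)
    (hc.smul_right _) k ?_
  rw [mul_add, ← mul_assoc, ← pow_succ, Algebra.algebraMap_eq_smul_one, mul_smul_comm,
    mul_one] at hq
  rw [mul_smul_comm, eq_neg_of_add_eq_zero_left hq, smul_neg, neg_smul, neg_neg, smul_smul,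
    inv_mul_cancel₀ hr0, one_smul]

theorem isAlgebraic_one_add (h : IsAlgebraic ℂ a) : IsAlgebraic ℂ (1 + a) := by
  obtain ⟨q, hq0, hq⟩ := h
  refine ⟨q.comp (Polynomial.X + Polynomial.C (-1)),
    Polynomial.comp_X_add_C_ne_zero_iff.2 hq0, ?_⟩
  rw [Polynomial.aeval_comp]
  simpa using hq

end Algebra

/-! ### Poles of the resolvent in a Banach algebra -/

section BanachAlgebra

variable {A : Type*} [NormedRing A] [NormedAlgebra ℂ A] {a c : A} {μ : ℂ}

/-- Comparison of Taylor coefficients: if `(w - c) * g = w ^ n` with `w = z - μ`, up to left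
multiplication by `c ^ k`, for some analytic `g` with values commuting with `c`, then
`c ^ (n + k)` is divisible by `c ^ (n + k + 1)`. The factor `c ^ k` makes the induction on `n` go
through: removing the constant term of `g` costs one factor `c`. -/
theorem exists_pow_eq_of_analyticAt (n k : ℕ) (g : ℂ → A) (hg : AnalyticAt ℂ g μ)
    (hc : ∀ᶠ z in 𝓝[≠] μ, Commute c (g z))
    (h : ∀ᶠ z in 𝓝[≠] μ, c ^ k * ((z - μ) • g z - c * g z) = (z - μ) ^ n • c ^ k) :
    ∃ x, Commute c x ∧ c ^ (n + k) = c ^ (n + k + 1) * x := by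
  have hw : Tendsto (fun z : ℂ => z - μ) (𝓝[≠] μ) (𝓝 0) := by
    have : Continuous fun z : ℂ => z - μ := by fun_prop
    simpa using (this.tendsto μ).mono_left nhdsWithin_le_nhds
  induction n generalizing k g with
  | zero =>
    have hg' : Tendsto g (𝓝[≠] μ) (𝓝 (g μ)) := hg.continuousAt.mono_left nhdsWithin_le_nhds
    have hcμ : c * g μ = g μ * c :=
      tendsto_nhds_unique_of_eventuallyEq (hg'.const_mul c) (hg'.mul_const c) hc
    have hl := tendsto_nhds_unique_of_eventuallyEq
      (((hw.smul hg').sub (hg'.const_mul c)).const_mul (c ^ k)) ((hw.pow 0).smul_const (c ^ k)) h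
    refine ⟨-g μ, (show Commute c (g μ) from hcμ).neg_right, ?_⟩
    simp only [zero_smul, zero_sub, pow_zero, one_smul] at hl
    rw [zero_add, ← hl, mul_neg, mul_neg, pow_succ, mul_assoc]
  | succ n ih =>
    have hg' : Tendsto g (𝓝[≠] μ) (𝓝 (g μ)) := hg.continuousAt.mono_left nhdsWithin_le_nhds
    have hcμ : Commute c (g μ) :=
      tendsto_nhds_unique_of_eventuallyEq (hg'.const_mul c) (hg'.mul_const c) hc
    have hl := tendsto_nhds_unique_of_eventuallyEq
      (((hw.smul hg').sub (hg'.const_mul c)).const_mul (c ^ k))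
      ((hw.pow (n + 1)).smul_const (c ^ k)) h
    have hl : c ^ (k + 1) * g μ = 0 := by
      simpa [pow_succ, mul_assoc] using hl
    obtain ⟨p, hp⟩ := hg
    have hd : AnalyticAt ℂ (dslope g μ) μ := ⟨_, hp.has_fpower_series_dslope_fslope⟩
    have hcd : ∀ᶠ z in 𝓝[≠] μ, Commute c (dslope g μ z) := by
      filter_upwards [hc, self_mem_nhdsWithin] with z hz hzμ
      rw [dslope_of_ne _ hzμ, slope_def_module]
      exact (hz.sub_right hcμ).smul_right _
    have heq : ∀ᶠ z in 𝓝[≠] μ, c ^ (k + 1) * ((z - μ) • dslope g μ z - c * dslope g μ z) =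
        (z - μ) ^ n • c ^ (k + 1) := by
      filter_upwards [h, self_mem_nhdsWithin] with z hz hzμ
      -- Substitute `g z = g μ + (z - μ) • dslope g μ z`, where `c ^ (k + 1) * g μ = 0`, into
      -- `c` times the hypothesis, and cancel one factor `z - μ`.
      have hw0 : z - μ ≠ 0 := sub_ne_zero.2 hzμ
      have hgz : g z = g μ + (z - μ) • dslope g μ z := by
        rw [sub_smul_dslope]; abel
      generalize dslope g μ z = d at hgz
      rw [← (smul_right_injective A hw0).eq_iff]
      have h1 : c ^ (k + 1) * g z = (z - μ) • (c ^ (k + 1) * d) := by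
        rw [hgz, mul_add, hl, zero_add, mul_smul_comm]
      have h2 : c ^ (k + 1) * (c * g z) = (z - μ) • (c ^ (k + 1) * (c * d)) := by
        rw [← mul_assoc, ← pow_succ, pow_succ', mul_assoc, h1, mul_smul_comm, ← mul_assoc,
          ← pow_succ', pow_succ, mul_assoc]
      have h3 := congrArg (c * ·) hz
      simp only [← mul_assoc, ← pow_succ', mul_smul_comm] at h3
      rw [mul_sub, mul_smul_comm, h1, h2] at h3
      rw [mul_sub, mul_smul_comm, smul_sub, h3, smul_smul, pow_succ']
    rw [show n + 1 + k = n + (k + 1) by ring]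
    exact ih (k + 1) (dslope g μ) hd hcd heq

theorem commute_resolvent (a : A) (z : ℂ) : Commute a (resolvent a z) := by
  have : Commute a (algebraMap ℂ A z - a) :=
    (show Commute a _ from (Algebra.commutes z a).symm).sub_right (Commute.refl a)
  by_cases h : IsUnit (algebraMap ℂ A z - a)
  · obtain ⟨v, hv⟩ := h
    rw [resolvent, ← hv, Ring.inverse_unit]
    rw [← hv] at this
    exact this.units_inv_right
  · rw [resolvent, Ring.inverse_non_unit _ h]
    exact Commute.zero_right a

/-- At a pole `μ` of order at most `n`, the function `(z - μ) ^ n • resolvent a z` is analytic, and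
comparing Taylor coefficients in `(z - a) * resolvent a z = 1` gives strong `π`-regularity. -/
theorem isDrazinInvertible_of_mem_resolventPoles (h : μ ∈ resolventPoles a) :
    IsDrazinInvertible (a - algebraMap ℂ A μ) := by
  obtain ⟨-, hiso, ⟨n, hn⟩, -⟩ := h
  have hc : ∀ z, Commute (a - algebraMap ℂ A μ) ((z - μ) ^ n • resolvent a z) := fun z =>
    ((commute_resolvent a z).sub_left (show Commute _ _ from Algebra.commutes μ _)).smul_right _
  have heq : ∀ᶠ z in 𝓝[≠] μ,
      (a - algebraMap ℂ A μ) ^ 0 * ((z - μ) • (z - μ) ^ n • resolvent a z -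
        (a - algebraMap ℂ A μ) * ((z - μ) ^ n • resolvent a z)) =
        (z - μ) ^ n • (a - algebraMap ℂ A μ) ^ 0 := by
    filter_upwards [hiso] with z hz
    have hu : IsUnit (algebraMap ℂ A z - a) := spectrum.notMem_iff.1 hz
    have : (algebraMap ℂ A z - a) * resolvent a z = 1 := Ring.mul_inverse_cancel _ hu
    rw [pow_zero, one_mul, Algebra.smul_def (z - μ), ← sub_mul, map_sub, sub_sub_sub_cancel_right,
      mul_smul_comm, this]
  obtain ⟨x, hx, hx'⟩ := exists_pow_eq_of_analyticAt n 0 _ hn (Eventually.of_forall hc) heq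
  exact isDrazinInvertible_of_pow_eq hx n hx'

/-- The Laurent expansion of the resolvent at `μ` when `c = a - μ` has Drazin inverse `b`: the
regular part is that of the invertible core `c * b`, the principal part is the finite Neumann
series of the nilpotent part of `c`. -/
theorem isUnit_sub_and_inverse_eq_laurent {b : A} {n : ℕ} (hcb : Commute c b) (hb : b * c * b = b)
    (hn : c ^ (n + 1) * b = c ^ n) {w : ℂ} (hw : w ≠ 0) (hu : IsUnit (1 - w • b)) :
    IsUnit (algebraMap ℂ A w - c) ∧ Ring.inverse (algebraMap ℂ A w - c) =
      -(b * Ring.inverse (1 - w • b)) +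
        ∑ k ∈ Finset.range n, (w⁻¹ ^ (k + 1)) • (c ^ k * (1 - c * b)) := by
  obtain ⟨v, hv⟩ := hu
  set f := -(b * Ring.inverse (1 - w • b)) +
        ∑ k ∈ Finset.range n, (w⁻¹ ^ (k + 1)) • (c ^ k * (1 - c * b)) with hf
  rw [← hv, Ring.inverse_unit] at hf
  have hcv : Commute c (v : A) := by
    rw [hv]; exact (Commute.one_right c).sub_right (hcb.smul_right w)
  have hcf : Commute c f := by
    rw [hf]
    refine ((hcb.mul_right hcv.units_inv_right).neg_right).add_right
      (Commute.sum_right _ _ _ fun k _ => ?_)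
    exact (((Commute.refl c).pow_right k).mul_right ((Commute.one_right c).sub_right
      ((Commute.refl c).mul_right hcb))).smul_right _
  have hcore : (algebraMap ℂ A w - c) * (b * ↑v⁻¹) = -(c * b) := by
    have : (algebraMap ℂ A w - c) * b = -(c * b) * v := by
      rw [hv, mul_sub, mul_one, mul_smul_comm, neg_mul, hcb.eq, hb, sub_mul, ← Algebra.smul_def,
        hcb.eq]
      simp [sub_eq_add_neg, add_comm]
    rw [← mul_assoc, this, mul_assoc, Units.mul_inv, mul_one]
  have hnil : (algebraMap ℂ A w - c) *
      ∑ k ∈ Finset.range n, (w⁻¹ ^ (k + 1)) • (c ^ k * (1 - c * b)) = 1 - c * b := by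
    have e1 : ∑ k ∈ Finset.range n, (w⁻¹ ^ (k + 1)) • (c ^ k * (1 - c * b)) =
        w⁻¹ • ((∑ k ∈ Finset.range n, (w⁻¹ • c) ^ k) * (1 - c * b)) := by
      rw [Finset.sum_mul, Finset.smul_sum]
      refine Finset.sum_congr rfl fun k _ => ?_
      rw [smul_pow, smul_mul_assoc, smul_smul, pow_succ']
    have e2 : w⁻¹ • (algebraMap ℂ A w - c) = 1 - w⁻¹ • c := by
      rw [smul_sub, Algebra.algebraMap_eq_smul_one, smul_smul, inv_mul_cancel₀ hw, one_smul]
    have e3 : c ^ n * (1 - c * b) = 0 := by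
      rw [mul_sub, mul_one, ← mul_assoc, ← pow_succ, hn, sub_self]
    rw [e1, mul_smul_comm, ← smul_mul_assoc, e2, ← mul_assoc, mul_neg_geom_sum, sub_mul, one_mul,
      smul_pow, smul_mul_assoc, e3, smul_zero, sub_zero]
  have h1 : (algebraMap ℂ A w - c) * f = 1 := by
    rw [hf, mul_add, mul_neg, hcore, hnil]; abel
  have h2 : f * (algebraMap ℂ A w - c) = 1 := by
    rw [← h1]
    exact ((show Commute f _ from (Algebra.commutes w f).symm).sub_right hcf.symm).eq
  let W : Aˣ := ⟨_, f, h1, h2⟩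
  exact ⟨W.isUnit, Ring.inverse_unit W⟩

theorem mem_resolventPoles_of_isDrazinInvertible [CompleteSpace A] (hμ : μ ∈ spectrum ℂ a)
    (h : IsDrazinInvertible (a - algebraMap ℂ A μ)) : μ ∈ resolventPoles a := by
  obtain ⟨b, hb, hbcb, n, hn⟩ := h.exists_doubleCommutant
  set c := a - algebraMap ℂ A μ with hc
  have hca : ∀ z, algebraMap ℂ A (z - μ) - c = algebraMap ℂ A z - a := by
    intro z; rw [hc, map_sub]; abel
  have han : AnalyticAt ℂ (fun z : ℂ => Ring.inverse (1 - (z - μ) • b)) μ := by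
    refine AnalyticAt.fun_comp (g := Ring.inverse) ?_ (by fun_prop)
    simpa using analyticAt_inverse (𝕜 := ℂ) (1 : Aˣ)
  have hunit : ∀ᶠ z in 𝓝[≠] μ, IsUnit (1 - (z - μ) • b) := by
    refine Filter.Eventually.filter_mono nhdsWithin_le_nhds ?_
    have hcont : Continuous fun z : ℂ => 1 - (z - μ) • b := by fun_prop
    exact hcont.continuousAt.eventually_mem
      (Units.isOpen.mem_nhds (by simp))
  have hiso : ∀ᶠ z in 𝓝[≠] μ, IsUnit (algebraMap ℂ A z - a) ∧ resolvent a z =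
      -(b * Ring.inverse (1 - (z - μ) • b)) +
        ∑ k ∈ Finset.range n, ((z - μ)⁻¹ ^ (k + 1)) • (c ^ k * (1 - c * b)) := by
    filter_upwards [hunit, self_mem_nhdsWithin] with z hz hzμ
    have := isUnit_sub_and_inverse_eq_laurent (hb c rfl).symm hbcb (hn n le_rfl)
      (sub_ne_zero.2 hzμ) hz
    rwa [hca] at this
  have hmer : MeromorphicAt (fun z : ℂ => resolvent a z) μ := by
    refine MeromorphicAt.congr (f := fun z : ℂ => -(b * Ring.inverse (1 - (z - μ) • b)) +
        ∑ k ∈ Finset.range n, ((z - μ)⁻¹ ^ (k + 1)) • (c ^ k * (1 - c * b))) ?_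
      (hiso.mono fun z hz => hz.2.symm)
    refine (analyticAt_const.mul han).neg.meromorphicAt.add (MeromorphicAt.fun_sum fun k => ?_)
    fun_prop
  refine ⟨hμ, hiso.mono fun z hz => spectrum.notMem_iff.2 hz.1, hmer, ?_⟩
  -- A nonnegative order would give the resolvent a limit at `μ`, which would invert `μ - a`.
  by_contra hord
  obtain ⟨l, hl⟩ := tendsto_nhds_of_meromorphicOrderAt_nonneg hmer (not_lt.1 hord)
  have hz : Tendsto (fun z : ℂ => algebraMap ℂ A z - a) (𝓝[≠] μ) (𝓝 (algebraMap ℂ A μ - a)) := by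
    have : Continuous fun z : ℂ => algebraMap ℂ A z - a :=
      (algebraMapCLM ℂ A).continuous.sub continuous_const
    exact (this.tendsto μ).mono_left nhdsWithin_le_nhds
  have h1 : (algebraMap ℂ A μ - a) * l = 1 :=
    tendsto_nhds_unique_of_eventuallyEq (hz.mul hl) tendsto_const_nhds
      (hiso.mono fun z hz => Ring.mul_inverse_cancel _ hz.1)
  have h2 : l * (algebraMap ℂ A μ - a) = 1 :=
    tendsto_nhds_unique_of_eventuallyEq (hl.mul hz) tendsto_const_nhds
      (hiso.mono fun z hz => Ring.inverse_mul_cancel _ hz.1)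
  exact hμ (Units.isUnit ⟨_, l, h1, h2⟩)

end BanachAlgebra

/-- Outside the spectrum Drazin invertibility is automatic; at a spectral point it means having a
pole of the resolvent. -/
theorem isMeromorphicOperator_iff {X : Type*} [NormedAddCommGroup X] [NormedSpace ℂ X]
    [CompleteSpace X] (T : X →L[ℂ] X) :
    IsMeromorphicOperator T ↔ drazinSpectrum T ⊆ {0} := by
  constructor
  · intro h μ hμ
    by_contra h0
    refine hμ ?_
    by_cases hs : μ ∈ spectrum ℂ T
    · exact isDrazinInvertible_of_mem_resolventPoles (h ⟨hs, h0⟩)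
    · have hu := (spectrum.notMem_iff.1 hs).neg
      rw [neg_sub] at hu
      exact isDrazinInvertible_of_isUnit hu
  · rintro h μ ⟨hs, h0⟩
    refine mem_resolventPoles_of_isDrazinInvertible hs ?_
    by_contra hd
    exact h0 (h hd)

/-! ### Multiplication operators -/

section Multiplication

variable {X : Type*} [NormedAddCommGroup X] [NormedSpace ℂ X]

theorem leftMul_mul (c d : X →L[ℂ] X) : leftMul (c * d) = leftMul c * leftMul d := by
  ext U : 1
  exact mul_assoc c d U

theorem rightMul_mul (c d : X →L[ℂ] X) : rightMul (c * d) = rightMul d * rightMul c := by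
  ext U : 1
  exact (mul_assoc U c d).symm

theorem leftMul_pow (c : X →L[ℂ] X) (n : ℕ) : leftMul c ^ n = leftMul (c ^ n) := by
  induction n with
  | zero => ext U : 1; simp [leftMul_apply]
  | succ n ih => rw [pow_succ, pow_succ, ih, leftMul_mul]

theorem rightMul_pow (c : X →L[ℂ] X) (n : ℕ) : rightMul c ^ n = rightMul (c ^ n) := by
  induction n with
  | zero => ext U : 1; simp [rightMul_apply]
  | succ n ih => rw [pow_succ, pow_succ', ih, rightMul_mul]

/-- The Drazin inverse `B` of `leftMul c` lies in its double commutant, hence commutes with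
right multiplications; so it is left multiplication by `B 1`. -/
theorem isDrazinInvertible_leftMul_iff (c : X →L[ℂ] X) :
    IsDrazinInvertible (leftMul c) ↔ IsDrazinInvertible c := by
  constructor
  · intro h
    obtain ⟨B, hB, -, n, hn⟩ := h.exists_doubleCommutant
    have hBU : ∀ U, B U = B 1 * U := by
      intro U
      have : Commute (leftMul c) (rightMul U) := by
        ext V : 1; simp [leftMul_apply, rightMul_apply, mul_assoc]
      simpa [rightMul_apply] using congrArg (· 1) (hB _ this).eq
    refine isDrazinInvertible_of_pow_eq (x := B 1) ?_ n ?_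
    · have : B (leftMul c 1) = leftMul c (B 1) := congrArg (· 1) (hB _ rfl).eq
      rw [leftMul_apply, leftMul_apply, mul_one] at this
      exact this.symm.trans (hBU c)
    · have := congrArg (· 1) (hn n le_rfl)
      simpa [leftMul_pow, leftMul_apply] using this.symm
  · rintro ⟨b, m, h1, h2, h3⟩
    refine ⟨leftMul b, m, ?_, ?_, ?_⟩
    · rw [leftMul_pow, ← leftMul_mul, ← leftMul_mul, h1]
    · rw [← leftMul_mul, ← leftMul_mul, h2]
    · rw [← leftMul_mul, ← leftMul_mul, h3]

theorem isDrazinInvertible_rightMul_iff (c : X →L[ℂ] X) :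
    IsDrazinInvertible (rightMul c) ↔ IsDrazinInvertible c := by
  constructor
  · intro h
    obtain ⟨B, hB, -, n, hn⟩ := h.exists_doubleCommutant
    have hBU : ∀ U, B U = U * B 1 := by
      intro U
      have : Commute (rightMul c) (leftMul U) := by
        ext V : 1; simp [leftMul_apply, rightMul_apply, mul_assoc]
      simpa [leftMul_apply] using congrArg (· 1) (hB _ this).eq
    have hc : Commute c (B 1) := by
      have : B (rightMul c 1) = rightMul c (B 1) := congrArg (· 1) (hB _ rfl).eq
      rw [rightMul_apply, rightMul_apply, one_mul] at this
      exact (hBU c).symm.trans this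
    refine isDrazinInvertible_of_pow_eq (x := B 1) hc n ?_
    have := congrArg (· 1) (hn n le_rfl)
    rw [(hc.pow_left (n + 1)).eq]
    simpa [rightMul_pow, rightMul_apply] using this.symm
  · rintro ⟨b, m, h1, h2, h3⟩
    have h1' : c * (b * c ^ m) = c ^ m := by
      rw [← mul_assoc, ((Commute.refl c).mul_left (show Commute b c from h3.symm)
        |>.pow_right m).eq, h3, ← mul_assoc, h1]
    refine ⟨rightMul b, m, ?_, ?_, ?_⟩
    · rw [rightMul_pow, ← rightMul_mul, ← rightMul_mul, h1']
    · rw [← rightMul_mul, ← rightMul_mul, ← mul_assoc, h2]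
    · rw [← rightMul_mul, ← rightMul_mul, h3]

theorem drazinSpectrum_leftMul (T : X →L[ℂ] X) :
    drazinSpectrum (leftMul T) = drazinSpectrum T := by
  ext μ
  have : leftMul T - algebraMap ℂ _ μ = leftMul (T - algebraMap ℂ _ μ) := by
    ext U : 1; simp [leftMul_apply, Algebra.algebraMap_eq_smul_one, sub_mul]
  simp only [drazinSpectrum, Set.mem_ofPred_eq, this, isDrazinInvertible_leftMul_iff]

theorem drazinSpectrum_rightMul (T : X →L[ℂ] X) :
    drazinSpectrum (rightMul T) = drazinSpectrum T := by
  ext μ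
  have : rightMul T - algebraMap ℂ _ μ = rightMul (T - algebraMap ℂ _ μ) := by
    ext U : 1; simp [rightMul_apply, Algebra.algebraMap_eq_smul_one, mul_sub]
  simp only [drazinSpectrum, Set.mem_ofPred_eq, this, isDrazinInvertible_rightMul_iff]

end Multiplication

/-! ### Perturbation by operators with a power of finite rank -/

section FiniteRank

variable {X : Type*} [NormedAddCommGroup X] [NormedSpace ℂ X] {F c : X →L[ℂ] X}

theorem finiteDimensional_range_mul (h : FiniteDimensional ℂ (F : X →ₗ[ℂ] X).range)
    (U : X →L[ℂ] X) : FiniteDimensional ℂ ((F * U : X →L[ℂ] X) : X →ₗ[ℂ] X).range :=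
  Submodule.finiteDimensional_of_le (S₂ := (F : X →ₗ[ℂ] X).range)
    (by rintro _ ⟨x, rfl⟩; exact ⟨U x, rfl⟩)

theorem isAlgebraic_of_finiteDimensional_range
    (h : FiniteDimensional ℂ (F : X →ₗ[ℂ] X).range) : IsAlgebraic ℂ F := by
  -- The restriction of `F` to its range satisfies a polynomial `q`; then `F` satisfies `q * X`.
  let V := (F : X →ₗ[ℂ] X).range
  let G : V →ₗ[ℂ] V := (F : X →ₗ[ℂ] X).restrict (p := V) (q := V) fun x _ => ⟨x, rfl⟩
  obtain ⟨q, hq0, hq⟩ := (Algebra.IsAlgebraic.isAlgebraic (R := ℂ) G)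
  have key : ∀ (r : Polynomial ℂ) (v : V), Polynomial.aeval F r (v : X) =
      (Polynomial.aeval G r v : X) := by
    intro r
    induction r using Polynomial.induction_on' with
    | add p q hp hq => intro v; simp [hp, hq]
    | monomial n t =>
      intro v
      have : ∀ n : ℕ, (F ^ n) (v : X) = ((G ^ n) v : X) := by
        intro n
        induction n with
        | zero => simp
        | succ n ih =>
          rw [pow_succ', pow_succ', mul_apply_eq_comp, ih]; rfl
      simp [Polynomial.aeval_monomial, Algebra.algebraMap_eq_smul_one, this]
  refine ⟨q * Polynomial.X, mul_ne_zero hq0 Polynomial.X_ne_zero, ?_⟩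
  ext x
  have := key q ⟨F x, x, rfl⟩
  simpa [hq] using this

theorem isAlgebraic_of_finiteDimensional_range_pow {n : ℕ} (hn : 0 < n)
    (h : FiniteDimensional ℂ ((F ^ n : X →L[ℂ] X) : X →ₗ[ℂ] X).range) : IsAlgebraic ℂ F :=
  (isAlgebraic_of_finiteDimensional_range h).of_pow hn

/-- Split along the idempotent `p = c * b`, where `b` is the Drazin inverse of `c`. On the core
`c + F` is `c * (1 + F * b)`; on the complement it is a perturbation of `F` by a nilpotent. In both
cases `F * b`, respectively the perturbed `F`, still has a power of finite rank. -/
theorem IsDrazinInvertible.add_of_finiteDimensional_range_pow (hc : IsDrazinInvertible c)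
    (hcF : Commute c F) {n : ℕ} (hn : 0 < n)
    (hF : FiniteDimensional ℂ ((F ^ n : X →L[ℂ] X) : X →ₗ[ℂ] X).range) :
    IsDrazinInvertible (c + F) := by
  obtain ⟨b, hb, hbcb, m, hm⟩ := hc.exists_doubleCommutant
  have hbF : Commute b F := hb F hcF
  have hcb : Commute c b := (hb c rfl).symm
  have hp : IsIdempotentElem (c * b) := by
    rw [IsIdempotentElem, mul_assoc, ← mul_assoc b, hbcb]
  have hpc : Commute c (c * b) := (Commute.refl c).mul_right hcb
  have hpF : Commute F (c * b) := hcF.symm.mul_right hbF.symm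
  refine isDrazinInvertible_of_corners hp (hpc.add_left hpF) ?_ ?_
  · have e : (c + F) * (c * b) = (c * (c * b)) * (1 + F * b) := by
      rw [mul_add, mul_one, add_mul]
      congr 1
      rw [hpF.eq, hpc.eq, mul_assoc (c * b) c, ← mul_assoc c F, hcF.eq, mul_assoc F,
        ← mul_assoc (c * b), ← hpF.eq, mul_assoc F, hp.eq]
    rw [e]
    have h1 : IsDrazinInvertible (c * (c * b)) :=
      hc.mul (isDrazinInvertible_of_pow_eq (Commute.one_right _) 1
        (by simp [hp.pow_succ_eq])) hpc
    refine h1.mul (isDrazinInvertible_of_isAlgebraic (isAlgebraic_one_add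
      (isAlgebraic_of_finiteDimensional_range_pow hn ?_))) ?_
    · rw [hbF.symm.mul_pow]
      exact finiteDimensional_range_mul hF _
    · exact (Commute.one_right _).add_right ((hcF.mul_left hpF.symm).mul_right
        (hcb.mul_left (hcb.mul_left (Commute.refl b))))
  · have hqc : Commute c (1 - c * b) := (Commute.one_right c).sub_right hpc
    have hqF : Commute F (1 - c * b) := (Commute.one_right F).sub_right hpF
    have hnil : (c * (1 - c * b)) ^ (m + 1) = 0 := by
      rw [hqc.mul_pow, hp.one_sub.pow_succ_eq, mul_sub, mul_one, ← mul_assoc, ← pow_succ,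
        hm _ (Nat.le_succ m), sub_self]
    have hcomm : Commute (F * (1 - c * b)) (c * (1 - c * b)) :=
      (hcF.symm.mul_right hqF).mul_left (hqc.symm.mul_right (Commute.refl _))
    obtain ⟨U, hU⟩ := ((Commute.refl _).add_right hcomm).pow_dvd_pow_of_sub_pow_eq_zero
      (p := n + m) (n := m + 1) (m := n) (by omega)
      (by rw [sub_add_cancel_left, neg_pow, hnil, mul_zero])
    rw [add_comm c F, add_mul]
    refine isDrazinInvertible_of_isAlgebraic (isAlgebraic_of_finiteDimensional_range_pow
      (n := n + m) (by omega) ?_)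
    rw [hU, hqF.mul_pow, mul_assoc]
    exact finiteDimensional_range_mul hF _

end FiniteRank

end DrazinSpectrum

theorem theorem3p1 {X : Type*} [NormedAddCommGroup X] [NormedSpace ℂ X] [CompleteSpace X]
    (T : X →L[ℂ] X) :
    List.TFAE
      [DrazinSpectrum.IsMeromorphicOperator T,
       DrazinSpectrum.drazinSpectrum T ⊆ {0},
       DrazinSpectrum.IsMeromorphicOperator (DrazinSpectrum.leftMul T),
       DrazinSpectrum.IsMeromorphicOperator (DrazinSpectrum.rightMul T)] ∧
    (∀ S : X →L[ℂ] X,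
      DrazinSpectrum.IsMeromorphicOperator (S * T) ↔
        DrazinSpectrum.IsMeromorphicOperator (T * S)) ∧
    (∀ F : X →L[ℂ] X,
      (∃ n : ℕ, 0 < n ∧
        FiniteDimensional ℂ (LinearMap.range ((F ^ n : X →L[ℂ] X) : X →ₗ[ℂ] X))) →
      F * T = T * F →
      DrazinSpectrum.IsMeromorphicOperator T →
      DrazinSpectrum.IsMeromorphicOperator (T + F)) := by
  simp only [DrazinSpectrum.isMeromorphicOperator_iff, DrazinSpectrum.drazinSpectrum_leftMul,
    DrazinSpectrum.drazinSpectrum_rightMul]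
  refine ⟨?_, fun S => ?_, ?_⟩
  · tfae_have 1 ↔ 2 := Iff.rfl
    tfae_have 1 ↔ 3 := Iff.rfl
    tfae_have 1 ↔ 4 := Iff.rfl
    tfae_finish
  · have swap : ∀ U V : X →L[ℂ] X, DrazinSpectrum.drazinSpectrum (U * V) ⊆ {0} →
        DrazinSpectrum.drazinSpectrum (V * U) ⊆ {0} := by
      intro U V h μ hμ
      by_contra h0
      exact hμ (DrazinSpectrum.IsDrazinInvertible.mul_sub_algebraMap_swap h0
        (by_contra fun hd => h0 (h hd)))
    exact ⟨swap S T, swap T S⟩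
  · rintro F ⟨n, hn, hF⟩ hFT h μ hμ
    by_contra h0
    have hd : DrazinSpectrum.IsDrazinInvertible (T - algebraMap ℂ (X →L[ℂ] X) μ) :=
      by_contra fun hd => h0 (h hd)
    have hcomm : Commute (T - algebraMap ℂ (X →L[ℂ] X) μ) F :=
      (show Commute T F from hFT.symm).sub_left (Algebra.commutes μ F)
    refine hμ ?_
    rw [add_sub_right_comm]
    exact hd.add_of_finiteDimensional_range_pow hcomm hn hF
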